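/- A partition $\mu$ is a finite weakly decreasing sequence $\mu_1\ge\dots\ge\mu_{l(\mu)}$ of positive integers; $l(\mu)$ is its length, $|\mu|=\sum_i\mu_i$ its weight, $m_i(\mu)$ the number of parts equal to $i$, and $z_\mu=\prod_{i\ge1} i^{m_i(\mu)}\,m_i(\mu)!$. For an integer $k\ge 0$, let $\left\langle{\mu\atop k}\right\rangle$ be the number of ways to choose $k$ points in the Ferrers diagram of $\mu$ (whose $i$-th row has $\mu_i$ points) so that at least one point is chosen on each row; for the empty partition and $k=0$ this number is $1$. For an integer $m\ge0$ put $(i)_m=i(i+1)\cdots(i+m-1)$ and $\binom{z}{m}=\frac{z(z-1)\cdots(z-m+1)}{m!}$. For a family of independent indeterminates $X=\{X_1,X_2,X_3,\ldots\}$ and integers $j,k\ge0$ put $$P_{jk}(X)=\sum_{|\mu|=j}\frac{\left\langle{\mu\atop k}\right\rangle}{z_\mu}\prod_{i\ge1}X_i^{m_i(\mu)},$$ so that $P_{00}(X)=1$. **Theorem 2.** Let $z$, $u$ and $X=\{X_1,X_2,X_3,\ldots\}$ be independent indeterminates over a commutative $\mathbb{Q}$-algebra $K$. For every integer $n\ge1$,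 the following identity of formal power series in $u$, with coefficients in the polynomial ring $K[z,X_1,X_2,\ldots]$, holds: $$\sum_{|\mu|=n}\frac{(-1)^{n-l(\mu)}}{z_\mu}\prod_{i\ge1}\left(z+\sum_{k\ge1}u^k\frac{(i)_k}{k!}X_k\right)^{m_i(\mu)}=\sum_{j\ge0}u^j\left(\sum_{k=0}^{\min(n,j)}\binom{z-j}{n-k}P_{jk}(X)\right).$$ -/

import Mathlib

namespace PartitionIdentity

/-- The length `l(μ)` of a partition. -/
def length {n : ℕ} (μ : n.Partition) : ℕ := μ.parts.card

/-- The multiplicity `m_i(μ)` of `i` in a partition. -/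
def mult {n : ℕ} (μ : n.Partition) (i : ℕ) : ℕ := μ.parts.count i

/-- `z_μ = ∏_{i ≥ 1} i ^ m_i(μ) * m_i(μ)!`; the factors with `m_i(μ) = 0` are `1` and are
left out. -/
def zee {n : ℕ} (μ : n.Partition) : ℕ :=
  ∏ i ∈ μ.parts.toFinset, i ^ mult μ i * (mult μ i).factorial

/-- The Ferrers diagram of a partition: row `i` has `μ_i` cells (rows and columns are numbered
from `0`). -/
def diagram {n : ℕ} (μ : n.Partition) : YoungDiagram :=
  YoungDiagram.ofRowLens (μ.parts.sort (· ≥ ·))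
    (Multiset.pairwise_sort μ.parts (· ≥ ·)).sortedGE

/-- The generalized binomial coefficient `⟨μ, r⟩`: the number of ways to choose `r` points of the
diagram of `μ` with at least one point chosen on each of its `l(μ)` rows. -/
def rowBinom {n : ℕ} (μ : n.Partition) (r : ℕ) : ℕ :=
  (((diagram μ).cells.powersetCard r).filter
    fun S => ∀ i ∈ Finset.range (length μ), ∃ c ∈ S, c.1 = i).card

/-- `P_{jk}(X) = ∑_{|μ| = j} ⟨μ, k⟩ / z_μ * ∏_{i ≥ 1} X_i ^ m_i(μ)`, for a family `X` of elements
of a commutative `ℚ`-algebra. The value `X 0` is not used, since partitions have positive parts. -/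
noncomputable def P {R : Type*} [CommRing R] [Algebra ℚ R] (X : ℕ → R) (j k : ℕ) : R :=
  ∑ μ : j.Partition,
    ((rowBinom μ k : ℚ) / (zee μ : ℚ)) • ∏ i ∈ μ.parts.toFinset, X i ^ mult μ i

/-- `binom(z, m) = z (z - 1) ⋯ (z - m + 1) / m!`. -/
noncomputable def binom {R : Type*} [CommRing R] [Algebra ℚ R] (z : R) (m : ℕ) : R :=
  (1 / (m.factorial : ℚ)) • (descPochhammer R m).eval z

/-- The formal power series `z + ∑_{k ≥ 1} u ^ k * (i)_k / k! * X_k` in the variable `u`, where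
`(i)_k = i (i + 1) ⋯ (i + k - 1)`. -/
noncomputable def rowSeries {R : Type*} [CommRing R] [Algebra ℚ R] (z : R) (X : ℕ → R) (i : ℕ) :
    PowerSeries R :=
  PowerSeries.C z +
    PowerSeries.mk fun k => if k = 0 then 0 else
      ((i.ascFactorial k : ℚ) / (k.factorial : ℚ)) • X k

/-- The left-hand side: the sum over the partitions `μ` of `n` of
`(-1) ^ (n - l(μ)) / z_μ * ∏_{i ≥ 1} (z + ∑_{k ≥ 1} u ^ k * (i)_k / k! * X_k) ^ m_i(μ)`
(note `l(μ) ≤ n`), a formal power series in `u`. -/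
noncomputable def partitionSum {R : Type*} [CommRing R] [Algebra ℚ R] (z : R) (X : ℕ → R)
    (n : ℕ) : PowerSeries R :=
  ∑ μ : n.Partition, ((-1 : ℚ) ^ (n - length μ) / (zee μ : ℚ)) •
    ∏ i ∈ μ.parts.toFinset, rowSeries z X i ^ mult μ i

/-- Names for the independent indeterminates `z`, `X_1, X_2, …`; the power series variable `u` is
separate, and `X 0` is a dummy that occurs nowhere. -/
inductive Indet where
  | z : Indet
  | X (k : ℕ) : Indet

end PartitionIdentity

/-!
Over all `n`, the left-hand side is the family of complete symmetric functions whose power sums are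
the signed row series `(-1) ^ (i + 1) * (z + ∑ k, u ^ k * (i)_k / k! * X_k)`, so it is determined
by Newton's recursion. Let the power series variable mark `n` and write `B r` for the binomial
series of exponent `r`. The coefficient of `u ^ j` in the solution is `B z * h_j`, where `h_j` is
the complete symmetric function with power sums `X_i * (1 - B (-i))`: as
`(-1) ^ m * (m + 1)_k / k!` is the coefficient of degree `m` in `B (-(k + 1))`, Newton's recursion
is the formula for the derivative of `B z * h_j`. Finally `1 - B (-i) = B (-1) ^ i * (B 1 ^ i - 1)`
turns `B z * h_j` into `B (z - j)` times the complete symmetric function with power sums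
`X_i * (B 1 ^ i - 1)`, and `B 1 ^ i - 1` enumerates the nonempty subsets of a row with `i` cells.
-/

namespace PartitionIdentity

open Finset
open scoped Nat PowerSeries

section CycleIndex

/-- `z_s` for a multiset `s` of positive integers, so that `zee μ` is `multisetZee μ.parts`: a
part can be removed from a multiset without changing its type. -/
def multisetZee (s : Multiset ℕ) : ℕ :=
  ∏ i ∈ s.toFinset, i ^ s.count i * (s.count i)!

theorem multisetZee_eq_mul_erase {s : Multiset ℕ} {i : ℕ} (hi : i ∈ s) :
    multisetZee s = s.count i * i * multisetZee (s.erase i) := by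
  have hi' : i ∈ s.toFinset := Multiset.mem_toFinset.2 hi
  have herase : multisetZee (s.erase i) =
      ∏ j ∈ s.toFinset, j ^ (s.erase i).count j * ((s.erase i).count j)! := by
    refine prod_subset (Multiset.toFinset_subset.2 (Multiset.erase_subset i s)) fun j _ hj => ?_
    rw [Multiset.count_eq_zero_of_notMem (mt Multiset.mem_toFinset.2 hj), pow_zero,
      Nat.factorial_zero, mul_one]
  have hrest : ∏ j ∈ s.toFinset.erase i, j ^ (s.erase i).count j * ((s.erase i).count j)! =
      ∏ j ∈ s.toFinset.erase i, j ^ s.count j * (s.count j)! :=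
    prod_congr rfl fun j hj => by rw [Multiset.count_erase_of_ne (ne_of_mem_erase hj)]
  obtain ⟨c, hc⟩ := Nat.exists_eq_succ_of_ne_zero (Multiset.count_ne_zero.2 hi)
  rw [herase, multisetZee, ← mul_prod_erase _ _ hi', ← mul_prod_erase _ _ hi', hrest,
    Multiset.count_erase_self, hc, Nat.succ_sub_one, Nat.factorial_succ, pow_succ,
    Nat.succ_eq_add_one]
  ring

theorem sum_sum_erase_parts {M : Type*} [AddCommMonoid M] (F : ℕ → Multiset ℕ → M) (n : ℕ) :
    ∑ μ : (n + 1).Partition, ∑ i ∈ μ.parts.toFinset, F i (μ.parts.erase i) =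
      ∑ p ∈ antidiagonal n, ∑ ν : p.2.Partition, F (p.1 + 1) ν.parts := by
  have hfiber : ∀ i ∈ Icc 1 (n + 1),
      ∑ μ : (n + 1).Partition with i ∈ μ.parts, F i (μ.parts.erase i) =
        ∑ ν : (n + 1 - i).Partition, F i ν.parts := by
    intro i hi
    obtain ⟨hi₁, hi₂⟩ := mem_Icc.1 hi
    rw [← Fintype.sum_equiv (Nat.Partition.partitionWithPartEquiv hi₁ hi₂)
      (fun μ => F i (μ.1.parts.erase i)) _ fun μ => by simp]
    exact (sum_subtype _ (by simp) fun μ : (n + 1).Partition => F i (μ.parts.erase i))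
  rw [sum_comm' (t' := Icc 1 (n + 1)) (s' := fun i => {μ | i ∈ μ.parts}), sum_congr rfl hfiber,
    Nat.sum_antidiagonal_eq_sum_range_succ (fun a b => ∑ ν : b.Partition, F (a + 1) ν.parts),
    range_eq_Ico]
  · rw [← Ico_add_one_right_eq_Icc, ← zero_add 1, ← sum_Ico_add' _ 0 (n + 1) 1]
    refine sum_congr rfl fun i _ => ?_
    rw [Nat.add_sub_add_right]
  · intro μ i
    simp only [mem_univ, true_and, Multiset.mem_toFinset, mem_filter, mem_Icc]
    exact ⟨fun h => ⟨h, μ.parts_pos h, Nat.Partition.le_of_mem_parts h⟩, And.left⟩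

theorem derivation_multiset_prod {S A : Type*} [CommSemiring S] [CommSemiring A] [Algebra S A]
    {ι : Type*} [DecidableEq ι] (D : Derivation S A A) (x : ι → A) (s : Multiset ι) :
    D (s.map x).prod = (s.map fun i => D (x i) * ((s.erase i).map x).prod).sum := by
  induction s using Multiset.induction with
  | empty => simp
  | cons i s ih =>
    have hs : ∀ j ∈ s, D (x j) * (((i ::ₘ s).erase j).map x).prod =
        x i * (D (x j) * ((s.erase j).map x).prod) := by
      intro j hj
      rw [Multiset.erase_cons_tail_of_mem hj, Multiset.map_cons, Multiset.prod_cons, mul_left_comm]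
    rw [Multiset.map_cons, Multiset.prod_cons, Derivation.leibniz, ih, Multiset.map_cons,
      Multiset.sum_cons, Multiset.map_congr rfl hs, Multiset.sum_map_mul_left,
      Multiset.erase_cons_head, smul_eq_mul, smul_eq_mul, add_comm, mul_comm (D (x i))]

theorem multiset_prod_pow_eq_pow_sum {M : Type*} [CommMonoid M] (c : M) (s : Multiset ℕ) :
    (s.map fun i => c ^ i).prod = c ^ s.sum := by
  induction s using Multiset.induction with
  | empty => simp
  | cons i s ih => rw [Multiset.map_cons, Multiset.prod_cons, ih, Multiset.sum_cons, pow_add]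

variable {R : Type*} [CommRing R] [Algebra ℚ R]

/-- The term `∏_{i ∈ s} x_i / z_s` of the cycle index that is indexed by the partition with
parts `s`. -/
noncomputable def cycleTerm (x : ℕ → R) (s : Multiset ℕ) : R :=
  (1 / multisetZee s : ℚ) • (s.map x).prod

/-- The cycle index polynomial `∑_{|μ| = n} x_μ / z_μ` of the symmetric group, which expresses the
complete symmetric function `h_n` in the power sums `x_i = p_i`. -/
noncomputable def cycleIndex (x : ℕ → R) (n : ℕ) : R :=
  ∑ μ : n.Partition, cycleTerm x μ.parts

theorem cycleIndex_zero (x : ℕ → R) : cycleIndex x 0 = 1 := by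
  simp [cycleIndex, cycleTerm, multisetZee]

theorem cycleIndex_pow_mul (c : R) (x : ℕ → R) (n : ℕ) :
    cycleIndex (fun i => c ^ i * x i) n = c ^ n * cycleIndex x n := by
  rw [cycleIndex, cycleIndex, mul_sum]
  refine sum_congr rfl fun μ _ => ?_
  rw [cycleTerm, cycleTerm, Multiset.prod_map_mul, mul_smul_comm,
    multiset_prod_pow_eq_pow_sum, μ.parts_sum]

theorem cycleTerm_erase {s : Multiset ℕ} (hs : ∀ j ∈ s, 0 < j) {i : ℕ} (hi : i ∈ s) (x : ℕ → R) :
    cycleTerm x (s.erase i) =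
      (1 / multisetZee s : ℚ) • (s.count i * i) • ((s.erase i).map x).prod := by
  have hz : (multisetZee s : ℚ) = (s.count i * i : ℕ) * multisetZee (s.erase i) := by
    exact_mod_cast multisetZee_eq_mul_erase hi
  have hz₀ : ((s.count i * i : ℕ) : ℚ) ≠ 0 :=
    Nat.cast_ne_zero.2 (mul_ne_zero (Multiset.count_ne_zero.2 hi) (hs i hi).ne')
  rw [cycleTerm, ← Nat.cast_smul_eq_nsmul ℚ, smul_smul, hz, one_div_mul_eq_div,
    div_mul_cancel_left₀ hz₀, one_div]

theorem smul_cycleTerm {s : Multiset ℕ} (hs : ∀ i ∈ s, 0 < i) (x : ℕ → R) :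
    s.sum • cycleTerm x s = ∑ i ∈ s.toFinset, x i * cycleTerm x (s.erase i) := by
  have hsum : s.sum = ∑ i ∈ s.toFinset, s.count i * i := by
    simpa only [smul_eq_mul] using sum_multiset_count s
  rw [hsum, sum_smul]
  refine sum_congr rfl fun i hi => ?_
  have hi' : i ∈ s := Multiset.mem_toFinset.1 hi
  rw [cycleTerm_erase hs hi', mul_smul_comm, mul_smul_comm, Multiset.prod_map_erase hi', cycleTerm,
    smul_comm]

theorem derivation_cycleTerm {S : Type*} [CommSemiring S] [Algebra S R] (D : Derivation S R R)
    {x d : ℕ → R} (hd : ∀ i, D (x i) = i • d i) {s : Multiset ℕ} (hs : ∀ i ∈ s, 0 < i) :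
    D (cycleTerm x s) = ∑ i ∈ s.toFinset, d i * cycleTerm x (s.erase i) := by
  rw [cycleTerm, map_rat_smul, derivation_multiset_prod, sum_multiset_map_count, smul_sum]
  refine sum_congr rfl fun i hi => ?_
  rw [cycleTerm_erase hs (Multiset.mem_toFinset.1 hi), hd, smul_mul_assoc, smul_smul, mul_smul_comm,
    mul_smul_comm]

theorem succ_smul_cycleIndex_succ (x : ℕ → R) (n : ℕ) :
    (n + 1) • cycleIndex x (n + 1) = ∑ p ∈ antidiagonal n, x (p.1 + 1) * cycleIndex x p.2 := by
  simp only [cycleIndex, mul_sum]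
  rw [← sum_sum_erase_parts fun i s => x i * cycleTerm x s, smul_sum]
  refine sum_congr rfl fun μ _ => ?_
  rw [← smul_cycleTerm (fun i => μ.parts_pos), μ.parts_sum]

theorem map_cycleIndex_succ_eq_zero {S : Type*} [CommRing S] [IsAddTorsionFree S] (f : R →+* S)
    {x : ℕ → R} (hx : ∀ i, f (x i) = 0) (n : ℕ) : f (cycleIndex x (n + 1)) = 0 := by
  refine (nsmul_eq_zero_iff_right n.succ_ne_zero).1 ?_
  rw [← map_nsmul, succ_smul_cycleIndex_succ, map_sum]
  exact sum_eq_zero fun p _ => by rw [map_mul, hx, zero_mul]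

theorem derivation_cycleIndex_succ {S : Type*} [CommSemiring S] [Algebra S R]
    (D : Derivation S R R) {x d : ℕ → R} (hd : ∀ i, D (x i) = i • d i) (n : ℕ) :
    D (cycleIndex x (n + 1)) = ∑ p ∈ antidiagonal n, d (p.1 + 1) * cycleIndex x p.2 := by
  simp only [cycleIndex, mul_sum]
  rw [← sum_sum_erase_parts fun i s => d i * cycleTerm x s, map_sum]
  exact sum_congr rfl fun μ _ => derivation_cycleTerm D hd fun i => μ.parts_pos

theorem eq_cycleIndex_of_succ_smul {x a : ℕ → R} (h_zero : a 0 = 1)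
    (h_succ : ∀ n, (n + 1) • a (n + 1) = ∑ p ∈ antidiagonal n, x (p.1 + 1) * a p.2) (n : ℕ) :
    a n = cycleIndex x n := by
  have := IsAddTorsionFree.of_module_rat R
  induction n using Nat.strong_induction_on with
  | _ n ih =>
    cases n with
    | zero => rw [h_zero, cycleIndex_zero]
    | succ n =>
      refine (nsmul_right_inj n.succ_ne_zero).1 ?_
      rw [h_succ, succ_smul_cycleIndex_succ]
      refine sum_congr rfl fun p hp => ?_
      rw [ih p.2 (Nat.lt_succ_of_le (HasAntidiagonal.antidiagonal.snd_le hp))]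

end CycleIndex

section FerrersRows

theorem eq_of_sum_powerset_eq {β M : Type*} [AddCommGroup M] {a b : Finset β → M}
    (h : ∀ I : Finset β, ∑ J ∈ I.powerset, a J = ∑ J ∈ I.powerset, b J) (I : Finset β) :
    a I = b I := by
  classical
  induction I using Finset.strongInduction with
  | H I ih =>
    have hproper : ∑ J ∈ I.ssubsets, a J = ∑ J ∈ I.ssubsets, b J :=
      sum_congr rfl fun J hJ => ih J (mem_ssubsets.1 hJ)
    have hI := h I
    rwa [← add_sum_erase _ a (mem_powerset_self I), ← add_sum_erase _ b (mem_powerset_self I),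
      ← ssubsets, hproper, add_left_inj] at hI

theorem sum_powerset_image_eq_prod {R α β : Type*} [CommRing R] [DecidableEq β]
    (w : α → R) (f : α → β) (C : Finset α) (I : Finset β) :
    ∑ S ∈ C.powerset with S.image f = I, ∏ c ∈ S, w c =
      ∏ i ∈ I, (∏ c ∈ C with f c = i, (1 + w c) - 1) := by
  suffices h : ∀ I : Finset β,
      ∑ J ∈ I.powerset, ∑ S ∈ C.powerset with S.image f = J, ∏ c ∈ S, w c =
        ∑ J ∈ I.powerset, ∏ i ∈ J, (∏ c ∈ C with f c = i, (1 + w c) - 1) from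
    eq_of_sum_powerset_eq h I
  intro I
  calc
    _ = ∑ S ∈ {c ∈ C | f c ∈ I}.powerset, ∏ c ∈ S, w c := by
      rw [← sum_fiberwise_of_maps_to (s := {c ∈ C | f c ∈ I}.powerset) (t := I.powerset)
        (g := image f) (by grind)]
      refine sum_congr rfl fun J hJ => sum_congr ?_ fun _ _ => rfl
      ext S
      have hJI : J ⊆ I := mem_powerset.1 hJ
      simp only [mem_filter, mem_powerset, subset_iff]
      grind
    _ = ∏ c ∈ C with f c ∈ I, (1 + w c) := by
      classical exact (prod_one_add _).symm
    _ = ∏ i ∈ I, ∏ c ∈ C with f c = i, (1 + w c) := by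
      rw [← prod_fiberwise_of_maps_to (s := {c ∈ C | f c ∈ I}) (t := I) (g := f) (by grind)]
      refine prod_congr rfl fun i hi => prod_congr ?_ fun _ _ => rfl
      grind
    _ = ∑ J ∈ I.powerset, ∏ i ∈ J, (∏ c ∈ C with f c = i, (1 + w c) - 1) := by
      rw [← prod_one_add]
      simp only [add_sub_cancel]

theorem rowLens_diagram {n : ℕ} (μ : n.Partition) :
    (diagram μ).rowLens = μ.parts.sort (· ≥ ·) :=
  YoungDiagram.rowLens_ofRowLens_eq_self fun _ hi => μ.parts_pos ((Multiset.mem_sort _).1 hi)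

theorem length_eq_colLen {n : ℕ} (μ : n.Partition) : length μ = (diagram μ).colLen 0 := by
  rw [← YoungDiagram.length_rowLens, rowLens_diagram, Multiset.length_sort, length]

theorem parts_eq_map_rowLen {n : ℕ} (μ : n.Partition) :
    μ.parts = (range (length μ)).val.map (diagram μ).rowLen := by
  rw [length_eq_colLen, range_val, ← Multiset.coe_range, Multiset.map_coe, ← YoungDiagram.rowLens,
    rowLens_diagram, Multiset.sort_eq]

theorem image_fst_cells_diagram {n : ℕ} (μ : n.Partition) :
    (diagram μ).cells.image Prod.fst = range (length μ) := by
  ext i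
  simp only [mem_image, mem_range, length_eq_colLen, ← YoungDiagram.mem_iff_lt_colLen,
    YoungDiagram.mem_cells]
  exact ⟨fun ⟨_, hc, hci⟩ => (diagram μ).up_left_mem hci.ge (Nat.zero_le _) hc,
    fun h => ⟨_, h, rfl⟩⟩

theorem card_cells_diagram {n : ℕ} (μ : n.Partition) : #(diagram μ).cells = n := by
  rw [card_eq_sum_card_image Prod.fst, image_fst_cells_diagram]
  calc
    _ = ∑ i ∈ range (length μ), (diagram μ).rowLen i :=
      sum_congr rfl fun i _ => ((diagram μ).rowLen_eq_card).symm
    _ = μ.parts.sum := by rw [parts_eq_map_rowLen μ]; rfl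
    _ = n := μ.parts_sum

theorem rowBinom_eq_zero {n k : ℕ} (μ : n.Partition) (h : n < k) : rowBinom μ k = 0 := by
  rw [rowBinom, powersetCard_eq_empty.2 (by rwa [card_cells_diagram]), filter_empty, card_empty]

theorem rowBinom_eq_card {n : ℕ} (μ : n.Partition) (k : ℕ) :
    rowBinom μ k =
      #{S ∈ (diagram μ).cells.powerset | S.image Prod.fst = range (length μ) ∧ k = #S} := by
  rw [rowBinom]
  congr 1
  ext S
  have himage : S ⊆ (diagram μ).cells → S.image Prod.fst ⊆ range (length μ) := fun hS =>
    (image_subset_image hS).trans_eq (image_fst_cells_diagram μ)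
  simp only [mem_filter, mem_powersetCard, mem_powerset, subset_antisymm_iff,
    @subset_iff _ (range _), mem_image]
  grind

theorem mk_rowBinom {R : Type*} [CommRing R] {n : ℕ} (μ : n.Partition) :
    PowerSeries.mk (fun k => (rowBinom μ k : R)) =
      (μ.parts.map fun i => (1 + PowerSeries.X) ^ i - 1).prod := by
  have hrow : ∀ i, ∏ c ∈ (diagram μ).cells with c.1 = i, (1 + PowerSeries.X : R⟦X⟧) =
      (1 + PowerSeries.X) ^ (diagram μ).rowLen i := fun i => by
    rw [prod_const, YoungDiagram.rowLen_eq_card, YoungDiagram.row]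
  calc
    _ = ∑ S ∈ (diagram μ).cells.powerset with S.image Prod.fst = range (length μ),
          (PowerSeries.X : R⟦X⟧) ^ #S := by
      ext k
      simp only [map_sum, PowerSeries.coeff_X_pow, PowerSeries.coeff_mk, sum_boole, filter_filter,
        rowBinom_eq_card]
    _ = ∏ i ∈ range (length μ), ((1 + PowerSeries.X) ^ (diagram μ).rowLen i - 1) := by
      simp only [← prod_const, sum_powerset_image_eq_prod, hrow]
    _ = (μ.parts.map fun i => (1 + PowerSeries.X) ^ i - 1).prod := by
      rw [prod_eq_multiset_prod, parts_eq_map_rowLen, Multiset.map_map, Function.comp_def]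

end FerrersRows

section BinomialSeries

open PowerSeries (C binomialSeries coeff derivative)

variable {R : Type*} [CommRing R] [BinomialRing R]

theorem coeff_binomialSeries (r : R) (n : ℕ) : coeff n (binomialSeries R r) = Ring.choose r n := by
  rw [PowerSeries.binomialSeries_coeff, smul_eq_mul, mul_one]

theorem derivative_binomialSeries (r : R) :
    derivative R (binomialSeries R r) = C r * binomialSeries R (r - 1) := by
  ext n
  have hchoose := Ring.choose_smul_choose r (Nat.le_add_left 1 n)
  rw [Nat.choose_one_right, Ring.choose_one_right, Nat.cast_one, Nat.add_sub_cancel, nsmul_eq_mul,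
    Nat.cast_succ] at hchoose
  rw [PowerSeries.coeff_derivative, PowerSeries.coeff_C_mul, coeff_binomialSeries,
    coeff_binomialSeries, mul_comm, hchoose]

theorem binomialSeries_sub_natCast (r : R) (n : ℕ) :
    binomialSeries R (r - n) = binomialSeries R r * binomialSeries R (-1 : R) ^ n := by
  induction n with
  | zero => simp
  | succ n ih =>
    rw [pow_succ, ← mul_assoc, ← ih, ← PowerSeries.binomialSeries_add, Nat.cast_succ,
      sub_add_eq_sub_sub, ← sub_eq_add_neg]

theorem one_sub_binomialSeries_neg_natCast (n : ℕ) :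
    1 - binomialSeries R (-n : R) =
      binomialSeries R (-1 : R) ^ n * ((1 + PowerSeries.X) ^ n - 1) := by
  rw [mul_sub_one, ← PowerSeries.binomialSeries_nat (R := R), mul_comm,
    ← binomialSeries_sub_natCast, sub_self, PowerSeries.binomialSeries_zero, ← zero_sub,
    binomialSeries_sub_natCast, PowerSeries.binomialSeries_zero, one_mul]

theorem choose_neg_succ (k m : ℕ) :
    Ring.choose (-(k + 1) : R) m = (-1) ^ m * (m + k).choose k := by
  rw [Ring.choose_neg, add_right_comm, add_sub_cancel_right, ← Nat.cast_add, Ring.choose_natCast,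
    add_comm k m, Nat.choose_symm_add, Units.smul_def, Int.coe_negOnePow_natCast, zsmul_eq_mul]
  push_cast
  rfl

theorem binom_eq_choose [Algebra ℚ R] (r : R) (m : ℕ) : binom r m = Ring.choose r m := by
  rw [binom, ← descPochhammer_map (algebraMap ℤ R), Polynomial.eval_map_algebraMap,
    Polynomial.aeval_eq_smeval, Ring.descPochhammer_eq_factorial_smul_choose,
    ← Nat.cast_smul_eq_nsmul ℚ, smul_smul,
    one_div_mul_cancel (Nat.cast_ne_zero.2 m.factorial_ne_zero), one_smul]

end BinomialSeries

section GeneratingSeries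

open PowerSeries (C binomialSeries coeff derivative)

theorem prod_pow_mult {M : Type*} [CommMonoid M] (x : ℕ → M) {n : ℕ} (μ : n.Partition) :
    ∏ i ∈ μ.parts.toFinset, x i ^ mult μ i = (μ.parts.map x).prod :=
  (prod_multiset_map_count _ _).symm

theorem neg_one_pow_sub_length {A : Type*} [CommRing A] {n : ℕ} (μ : n.Partition) :
    (-1 : A) ^ (n - length μ) = (μ.parts.map fun i => (-1) ^ (i + 1)).prod := by
  have hlength : length μ ≤ n := by
    simpa [length, μ.parts_sum] using Multiset.card_nsmul_le_sum fun i hi => μ.parts_pos hi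
  simp only [pow_succ, Multiset.prod_map_mul, multiset_prod_pow_eq_pow_sum, μ.parts_sum]
  rw [Multiset.map_const', Multiset.prod_replicate, ← length, ← pow_sub_mul_pow _ hlength,
    mul_assoc, ← mul_pow, neg_mul_neg, one_mul, one_pow, mul_one]

variable {R : Type*} [CommRing R] [Algebra ℚ R]

theorem mk_P (X : ℕ → R) (j : ℕ) :
    PowerSeries.mk (P X j) = cycleIndex (fun i => C (X i) * ((1 + PowerSeries.X) ^ i - 1)) j := by
  ext k
  rw [PowerSeries.coeff_mk, P, cycleIndex, map_sum]
  refine sum_congr rfl fun μ _ => ?_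
  rw [prod_pow_mult, cycleTerm, Multiset.prod_map_mul, ← mk_rowBinom, Multiset.prod_hom',
    PowerSeries.coeff_smul, PowerSeries.coeff_C_mul, PowerSeries.coeff_mk, div_eq_mul_one_div,
    mul_comm, mul_smul, Nat.cast_smul_eq_nsmul, nsmul_eq_mul, mul_comm]
  rfl

theorem P_eq_zero (X : ℕ → R) {j k : ℕ} (h : j < k) : P X j k = 0 := by
  simp only [P, rowBinom_eq_zero _ h, Nat.cast_zero, zero_div, zero_smul, sum_const_zero]

theorem partitionSum_eq_cycleIndex (z : R) (X : ℕ → R) (n : ℕ) :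
    partitionSum z X n = cycleIndex (fun i => (-1) ^ (i + 1) * rowSeries z X i) n := by
  refine sum_congr rfl fun μ _ => ?_
  rw [prod_pow_mult, cycleTerm, Multiset.prod_map_mul, ← neg_one_pow_sub_length, div_eq_mul_one_div,
    mul_comm, mul_smul, Algebra.smul_def ((-1 : ℚ) ^ _), map_pow, map_neg, map_one]
  rfl

-- Storing `z` in the unused slot `X 0` makes the constant term fit the general pattern.
theorem coeff_rowSeries_succ (z : R) (X : ℕ → R) (m k : ℕ) :
    coeff k (rowSeries z X (m + 1)) = (m + k).choose k * Function.update X 0 z k := by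
  cases k with
  | zero => simp [rowSeries]
  | succ k =>
    rw [rowSeries, map_add, PowerSeries.coeff_C, PowerSeries.coeff_mk, if_neg k.succ_ne_zero,
      if_neg k.succ_ne_zero, zero_add, Nat.ascFactorial_eq_factorial_mul_choose, Nat.cast_mul,
      mul_div_cancel_left₀ _ (Nat.cast_ne_zero.2 (Nat.factorial_ne_zero _)),
      Nat.cast_smul_eq_nsmul, nsmul_eq_mul, Function.update_of_ne k.succ_ne_zero]

theorem coeff_signed_rowSeries_succ [BinomialRing R] (z : R) (X : ℕ → R) (m k : ℕ) :
    coeff k ((-1) ^ (m + 1 + 1) * rowSeries z X (m + 1)) =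
      Function.update X 0 z k * Ring.choose (-(k + 1) : R) m := by
  have hneg : (-1 : R⟦X⟧) ^ (m + 1 + 1) = C ((-1) ^ m) := by
    rw [pow_succ, pow_succ, mul_assoc, neg_mul_neg, one_mul, mul_one, map_pow, map_neg, map_one]
  rw [hneg, PowerSeries.coeff_C_mul, coeff_rowSeries_succ, choose_neg_succ]
  ring

/-- The coefficient of `u ^ j` in the generating series `∑ n, t ^ n * partitionSum z X n`, given in
closed form as a power series in `t`. -/
noncomputable def columnSeries [BinomialRing R] (z : R) (X : ℕ → R) (j : ℕ) : R⟦X⟧ :=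
  binomialSeries R z * cycleIndex (fun i => C (X i) * (1 - binomialSeries R (-i : R))) j

theorem columnSeries_eq_binomialSeries_mul_mk_P [BinomialRing R] (z : R) (X : ℕ → R) (j : ℕ) :
    columnSeries z X j = binomialSeries R (z - j) * PowerSeries.mk (P X j) := by
  simp only [columnSeries, one_sub_binomialSeries_neg_natCast, mul_left_comm (C _)]
  rw [cycleIndex_pow_mul, mk_P, binomialSeries_sub_natCast, mul_assoc]

theorem coeff_columnSeries [BinomialRing R] (z : R) (X : ℕ → R) (j n : ℕ) :
    coeff n (columnSeries z X j) =
      ∑ k ∈ range (min n j + 1), binom (z - j) (n - k) * P X j k := by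
  rw [columnSeries_eq_binomialSeries_mul_mk_P, mul_comm, PowerSeries.coeff_mul,
    Nat.sum_antidiagonal_eq_sum_range_succ_mk]
  simp only [PowerSeries.coeff_mk, coeff_binomialSeries, ← binom_eq_choose, mul_comm (P _ _ _)]
  refine (sum_subset (range_mono (by omega)) fun k hk hk' => ?_).symm
  rw [mem_range] at hk hk'
  rw [P_eq_zero X (by omega), mul_zero]

theorem coeff_zero_columnSeries [BinomialRing R] (z : R) (X : ℕ → R) (j : ℕ) :
    coeff 0 (columnSeries z X j) = if j = 0 then 1 else 0 := by
  cases j with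
  | zero => simp [columnSeries, cycleIndex_zero]
  | succ j =>
    have := IsAddTorsionFree.of_module_rat R
    rw [if_neg j.succ_ne_zero, PowerSeries.coeff_zero_eq_constantCoeff_apply, columnSeries, map_mul,
      map_cycleIndex_succ_eq_zero, mul_zero]
    simp

theorem derivative_columnSeries [BinomialRing R] (z : R) (X : ℕ → R) (j : ℕ) :
    derivative R (columnSeries z X j) = ∑ q ∈ antidiagonal j,
      C (Function.update X 0 z q.1) * binomialSeries R (-(q.1 + 1) : R) * columnSeries z X q.2 := by
  have hx (i : ℕ) : derivative R (C (X i) * (1 - binomialSeries R (-i : R))) =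
      i • (C (X i) * binomialSeries R (-(i + 1) : R)) := by
    rw [Derivation.leibniz, map_sub, PowerSeries.derivative_one, derivative_binomialSeries,
      PowerSeries.derivative_C, map_neg, smul_zero, add_zero, zero_sub, smul_eq_mul, neg_mul,
      neg_neg, map_natCast, nsmul_eq_mul, mul_left_comm, neg_add']
  have hz : derivative R (binomialSeries R z) =
      C z * binomialSeries R (-1 : R) * binomialSeries R z := by
    rw [derivative_binomialSeries, sub_eq_neg_add, PowerSeries.binomialSeries_add, mul_assoc]
  cases j with
  | zero => simp [columnSeries, cycleIndex_zero, hz]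
  | succ j =>
    rw [Nat.sum_antidiagonal_succ, columnSeries, Derivation.leibniz,
      derivation_cycleIndex_succ _ hx, hz, add_comm, smul_eq_mul, smul_eq_mul, mul_sum]
    congr 1
    · rw [Function.update_self, Nat.cast_zero, zero_add]
      ring
    · refine sum_congr rfl fun p _ => ?_
      rw [Function.update_of_ne p.1.succ_ne_zero, columnSeries, Nat.cast_succ]
      ring

theorem succ_nsmul_coeff_columnSeries [BinomialRing R] (z : R) (X : ℕ → R) (n j : ℕ) :
    (n + 1) • coeff (n + 1) (columnSeries z X j) = ∑ p ∈ antidiagonal n, ∑ q ∈ antidiagonal j,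
      Function.update X 0 z q.1 * Ring.choose (-(q.1 + 1) : R) p.1 *
        coeff p.2 (columnSeries z X q.2) := by
  rw [nsmul_eq_mul, mul_comm, Nat.cast_succ, ← PowerSeries.coeff_derivative,
    derivative_columnSeries, map_sum, sum_comm]
  refine sum_congr rfl fun q _ => ?_
  rw [mul_assoc, PowerSeries.coeff_C_mul, PowerSeries.coeff_mul, mul_sum]
  simp only [coeff_binomialSeries, mul_assoc]

theorem partitionSum_eq_mk_coeff_columnSeries [BinomialRing R] (z : R) (X : ℕ → R) (n : ℕ) :
    partitionSum z X n = PowerSeries.mk fun j => coeff n (columnSeries z X j) := by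
  rw [partitionSum_eq_cycleIndex]
  symm
  refine eq_cycleIndex_of_succ_smul
    (a := fun m => PowerSeries.mk fun j => coeff m (columnSeries z X j)) ?_ (fun m => ?_) n
  · ext j
    rw [PowerSeries.coeff_mk, coeff_zero_columnSeries, PowerSeries.coeff_one]
  · ext j
    rw [map_nsmul, PowerSeries.coeff_mk, succ_nsmul_coeff_columnSeries, map_sum]
    refine sum_congr rfl fun p _ => ?_
    rw [PowerSeries.coeff_mul]
    simp only [coeff_signed_rowSeries_succ, PowerSeries.coeff_mk]

end GeneratingSeries

end PartitionIdentity

theorem mainTheorem2_general {R : Type*} [CommRing R] [Algebra ℚ R] (z : R) (X : ℕ → R) (n : ℕ) :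
    PartitionIdentity.partitionSum z X n =
      PowerSeries.mk fun j => ∑ k ∈ Finset.range (min n j + 1),
        PartitionIdentity.binom (z - (j : R)) (n - k) * PartitionIdentity.P X j k := by
  -- Mathlib derives that a `ℚ`-algebra is a binomial ring from its `ℚ≥0`-module structure.
  let : Module ℚ≥0 R := Module.compHom R (algebraMap ℚ≥0 ℚ)
  rw [PartitionIdentity.partitionSum_eq_mk_coeff_columnSeries]
  simp only [PartitionIdentity.coeff_columnSeries]

theorem mainTheorem2 (K : Type*) [CommRing K] [Algebra ℚ K] (n : ℕ) (hn : 1 ≤ n)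
    (z : MvPolynomial PartitionIdentity.Indet K)
    (hz : z = MvPolynomial.X PartitionIdentity.Indet.z)
    (X : ℕ → MvPolynomial PartitionIdentity.Indet K)
    (hX : ∀ k, X k = MvPolynomial.X (PartitionIdentity.Indet.X k)) :
    PartitionIdentity.partitionSum z X n =
      PowerSeries.mk fun j =>
        ∑ k ∈ Finset.range (min n j + 1),
          PartitionIdentity.binom (z - (j : MvPolynomial PartitionIdentity.Indet K)) (n - k) *
            PartitionIdentity.P X j k :=
  mainTheorem2_general z X n
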